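/- Let $L\ge 1$ and $l\ge 1$ be fixed integers, and let $h_{i,j}$ ($i\ge 1$, $1\le j\le L$) be independent circularly symmetric complex Gaussian random variables with zero mean and unit variance ($\mathcal{CN}(0,1)$). Let $X_i=\sum_{j=1}^{L}|h_{i,j}|^2$, let $F_X$ be the common distribution function of the $X_i$, and for each $n$ let $X_{i_1}\le X_{i_2}\le\cdots\le X_{i_n}$ be the nondecreasing rearrangement of $X_1,\dots,X_n$. Put $$a_n=\inf\Big\{x:\ 1-F_X(x)\le \frac1n\Big\},\qquad b_n=\frac{\sum_{i=0}^{L-1}\frac{L-i}{i!}a_n^i}{\sum_{i=0}^{L-1}\frac{1}{i!}a_n^i}.$$ Then $$\lim_{n\to\infty}\mathrm{E}\left[\frac{\sum_{k=1}^{l}X_{i_{n-k+1}}-l\,a_n}{b_n}\right]=l\left(\mu_1+1-\sum_{k=1}^{l}\frac1k\right),$$ where the random variables in the expectations are integrable for all $n\ge l$, and where $$\mu_1=\int_{-\infty}^{+\infty}x\,\mathrm{d}\,e^{-e^{-x}}$$ is a convergent integral equal to Euler's constant $\gamma=0.5772\ldots$. -/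

import Mathlib

open MeasureTheory ProbabilityTheory Filter Topology

noncomputable section

/-- The circularly symmetric complex Gaussian law `CN(0,1)`: real and imaginary parts are
independent real Gaussians with mean `0` and variance `1/2`, so that `E |h|^2 = 1`. -/
def stdComplexGaussian : Measure ℂ :=
  ((gaussianReal 0 (1 / 2)).prod (gaussianReal 0 (1 / 2))).map (fun p : ℝ × ℝ => (⟨p.1, p.2⟩ : ℂ))

/-- The quantity `∑ j, |z_j|^2` of a complex vector. -/
def gain {L : ℕ} (z : Fin L → ℂ) : ℝ := ∑ j, ‖z j‖ ^ 2

/-- The law of `X = ∑ j, |h_j|^2` for independent `h_j ∼ CN(0,1)`, `1 ≤ j ≤ L`. -/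
def gainLaw (L : ℕ) : Measure ℝ :=
  (Measure.pi (fun _ : Fin L => stdComplexGaussian)).map gain

/-- `a_n = inf {x : 1 - F_X(x) ≤ 1/n}`, where `F_X` is the distribution function of `X`.
(For `n ≥ 2` and `L ≥ 1` the set is nonempty and bounded below.) -/
def aSeq (L n : ℕ) : ℝ := sInf {x : ℝ | 1 - cdf (gainLaw L) x ≤ 1 / (n : ℝ)}

/-- `b_n = (∑_{i<L} (L-i)/i! a_n^i) / (∑_{i<L} 1/i! a_n^i)`. -/
def bSeq (L n : ℕ) : ℝ :=
  (∑ i ∈ Finset.range L, ((L : ℝ) - (i : ℝ)) / (i.factorial : ℝ) * aSeq L n ^ i) /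
    (∑ i ∈ Finset.range L, 1 / (i.factorial : ℝ) * aSeq L n ^ i)

/-- The `m`-th entry, `1 ≤ m ≤ n`, of the nondecreasing rearrangement of `x_1, …, x_n`
(the value `0` is used for `m` outside this range). -/
def orderStat {n : ℕ} (x : Fin n → ℝ) (m : ℕ) : ℝ :=
  if hm : 1 ≤ m ∧ m ≤ n then x (Tuple.sort x ⟨m - 1, by omega⟩) else 0

/-- `∑_{k=1}^{l} x_{(n-k+1)}`, the sum of the `l` largest of `x_1, …, x_n`, for `l ≤ n`. -/
def topSum {n : ℕ} (l : ℕ) (x : Fin n → ℝ) : ℝ :=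
  ∑ k ∈ Finset.Icc 1 l, orderStat x (n - k + 1)

/-- The distribution function `x ↦ exp (-exp (-x))`. -/
def gumbelCDF : StieltjesFunction ℝ where
  toFun x := Real.exp (-Real.exp (-x))
  mono' := by
    intro x y hxy
    simp only [Real.exp_le_exp, neg_le_neg_iff]
    exact hxy
  right_continuous' := fun x => by
    apply Continuous.continuousWithinAt
    fun_prop

/-- `μ₁ = ∫ x d(exp (-exp (-x)))`, a Lebesgue–Stieltjes integral over the real line. -/
def gumbelMean : ℝ := ∫ x, x ∂gumbelCDF.measure

end

/-! Write `G = gammaTail L`. The Gaussian vector has a radial density on a real space of dimension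
`2 * L`, so polar coordinates give `P(X > x) = G x` for `x ≥ 0`, and `a_n` solves `G a_n = 1/n`.

The `k`-th largest value exceeds `t` iff at least `k` samples do, a binomial event. Hence `E
X_(n-k+1) - a_n` is the integral over `t > 0` of `binomTail n k (G t) - 1_{t < a_n}`. With `t = a_n
+ u`, `tendsto_gammaTail_add_div` gives `n * G (a_n + u) → e^{-u}`, and the Poisson limit theorem
turns the integrand into `centredTail k u`. Submultiplicativity of `G` (`gammaTail_add_le`) bounds
it by `k ^ 2 * G |u|` uniformly in `n` (`norm_centredBinomTail_le`), so dominated convergence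
applies.

For `k = 1` the limit integral is the Gumbel mean, that is `-Γ'(1) = γ`. Passing from `k` to `k + 1`
subtracts a Poisson term of integral `1/k`, so the `k`-th limit is `γ - H_{k-1}`. Summing over `k ≤
l` and using `b_n → 1` gives the result. -/

/-- The tail `x ↦ e^{-x} ∑_{i<L} x^i / i!` of the Gamma distribution with integer shape `L`. -/
noncomputable def gammaTail (L : ℕ) (x : ℝ) : ℝ :=
  Real.exp (-x) * ∑ i ∈ Finset.range L, x ^ i / (i.factorial : ℝ)

/-- The derivatives of consecutive summands telescope, leaving minus the Gamma density. -/
lemma hasDerivAt_gammaTail (L : ℕ) (x : ℝ) :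
    HasDerivAt (gammaTail (L + 1)) (-(Real.exp (-x) * (x ^ L / (L.factorial : ℝ)))) x := by
  have hexp : HasDerivAt (fun x : ℝ => Real.exp (-x)) (-Real.exp (-x)) x := by
    simpa using (hasDerivAt_neg x).exp
  induction L with
  | zero =>
    have : gammaTail (0 + 1) = fun x : ℝ => Real.exp (-x) := by
      ext y; simp [gammaTail]
    rw [this]
    simpa using hexp
  | succ L ih =>
    have : gammaTail (L + 1 + 1) = fun x : ℝ => gammaTail (L + 1) x +
        Real.exp (-x) * (x ^ (L + 1) / ((L + 1).factorial : ℝ)) := by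
      ext y; simp only [gammaTail]; rw [Finset.sum_range_succ _ (L + 1), mul_add]
    rw [this]
    refine (ih.add (hexp.mul ((hasDerivAt_pow (L + 1) x).div_const _))).congr_deriv ?_
    have h1 : ((L + 1).factorial : ℝ) = (L + 1) * (L.factorial : ℝ) := by
      push_cast [Nat.factorial_succ]; ring
    have h2 : (L.factorial : ℝ) ≠ 0 := by positivity
    have h3 : (L : ℝ) + 1 ≠ 0 := by positivity
    rw [h1]
    push_cast
    field_simp
    ring

lemma continuous_gammaTail (L : ℕ) : Continuous (gammaTail L) := by
  unfold gammaTail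
  fun_prop

lemma gammaTail_zero_right {L : ℕ} (hL : 1 ≤ L) : gammaTail L 0 = 1 := by
  obtain ⟨m, rfl⟩ := Nat.exists_eq_add_of_le' hL
  simp [gammaTail, Finset.sum_range_succ']

lemma gammaTail_nonneg (L : ℕ) {x : ℝ} (hx : 0 ≤ x) : 0 ≤ gammaTail L x := by
  unfold gammaTail
  positivity

lemma tendsto_gammaTail_atTop (L : ℕ) : Tendsto (gammaTail L) atTop (𝓝 0) := by
  have : gammaTail L = fun x => ∑ i ∈ Finset.range L, (x ^ i * Real.exp (-x)) / (i.factorial : ℝ) := by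
    ext x
    rw [gammaTail, Finset.mul_sum]
    exact Finset.sum_congr rfl fun i _ => by ring
  rw [this, show (0 : ℝ) = ∑ i ∈ Finset.range L, 0 / (i.factorial : ℝ) by simp]
  exact tendsto_finsetSum _ fun i _ =>
    (Real.tendsto_pow_mul_exp_neg_atTop_nhds_zero i).div_const _

/-! ### The gain has a Gamma law -/

/-- A product of measures with densities has the product density. -/
lemma pi_withDensity_ofReal {ι : Type*} [Fintype ι] {α : Type*} [MeasurableSpace α]
    (μ : Measure α) [SigmaFinite μ] (f : α → ℝ) (hf0 : ∀ x, 0 ≤ f x)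
    (hfi : Integrable f μ) :
    Measure.pi (fun _ : ι => μ.withDensity (fun x => ENNReal.ofReal (f x))) =
      (Measure.pi (fun _ : ι => μ)).withDensity (fun x => ENNReal.ofReal (∏ i, f (x i))) := by
  refine Measure.pi_eq fun s hs => ?_
  have hms : MeasurableSet (Set.univ.pi s) := MeasurableSet.univ_pi hs
  rw [withDensity_apply _ hms, ← lintegral_indicator hms]
  have key : ∀ x : ι → α, (Set.univ.pi s).indicator
      (fun x => ENNReal.ofReal (∏ i, f (x i))) x =
        ENNReal.ofReal (∏ i, (s i).indicator f (x i)) := by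
    intro x
    by_cases hx : x ∈ Set.univ.pi s
    · rw [Set.indicator_of_mem hx]
      congr 1
      exact Finset.prod_congr rfl fun i _ => (Set.indicator_of_mem (hx i trivial) _).symm
    · rw [Set.indicator_of_notMem hx]
      simp only [Set.mem_univ_pi, not_forall] at hx
      obtain ⟨i, hi⟩ := hx
      rw [Finset.prod_eq_zero (Finset.mem_univ i) (Set.indicator_of_notMem hi _)]
      simp
  simp_rw [key]
  have hint : ∀ i, Integrable ((s i).indicator f) μ := fun i => hfi.indicator (hs i)
  have hnn : ∀ i x, 0 ≤ (s i).indicator f x := fun i x => Set.indicator_nonneg (fun y _ => hf0 y) x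
  rw [← ofReal_integral_eq_lintegral_ofReal (Integrable.fintype_prod hint)
    (ae_of_all _ fun x => Finset.prod_nonneg fun i _ => hnn i _),
    integral_fintype_prod_eq_prod (fun i => (s i).indicator f),
    ENNReal.ofReal_prod_of_nonneg fun i _ => integral_nonneg (hnn i)]
  refine Finset.prod_congr rfl fun i _ => ?_
  rw [ofReal_integral_eq_lintegral_ofReal (hint i) (ae_of_all _ (hnn i)),
    withDensity_apply _ (hs i), ← lintegral_indicator (hs i)]
  refine lintegral_congr fun x => ?_
  by_cases hx : x ∈ s i <;> simp [hx]

/-- The density depends on `‖z‖` alone, so the density of the whole vector is a function of `gain`.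
-/
lemma stdComplexGaussian_eq_withDensity :
    stdComplexGaussian = (volume : Measure ℂ).withDensity
      (fun z => ENNReal.ofReal (Real.pi⁻¹ * Real.exp (-‖z‖ ^ 2))) := by
  have h2 : (1 / 2 : NNReal) ≠ 0 := by norm_num
  have hmp := Complex.volume_preserving_equiv_real_prod.symm
  rw [stdComplexGaussian, gaussianReal_of_var_ne_zero _ h2,
    prod_withDensity (measurable_gaussianPDF _ _) (measurable_gaussianPDF _ _)]
  have hmap : (fun p : ℝ × ℝ => (⟨p.1, p.2⟩ : ℂ)) = Complex.measurableEquivRealProd.symm := by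
    ext p; simp
  rw [hmap]
  ext s hs
  rw [Measure.map_apply hmp.measurable hs, withDensity_apply _ (hmp.measurable hs),
    withDensity_apply _ hs, ← hmp.setLIntegral_comp_preimage hs (by fun_prop)]
  refine setLIntegral_congr_fun (hmp.measurable hs) fun p _ => ?_
  simp only [gaussianPDF, gaussianPDFReal]
  rw [← ENNReal.ofReal_mul (by positivity)]
  congr 1
  have hn : ‖Complex.measurableEquivRealProd.symm p‖ ^ 2 = p.1 ^ 2 + p.2 ^ 2 := by
    rw [← hmap, Complex.sq_norm, Complex.normSq_apply]; ring
  have hs : √(2 * Real.pi * ((1 / 2 : NNReal) : ℝ)) = √Real.pi := by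
    congr 1; push_cast; ring
  rw [hn, hs]
  have h3 : (√Real.pi)⁻¹ * (√Real.pi)⁻¹ = Real.pi⁻¹ := by
    rw [← mul_inv, Real.mul_self_sqrt Real.pi_pos.le]
  rw [mul_mul_mul_comm, h3, ← Real.exp_add]
  congr 2
  push_cast
  ring

instance isProbabilityMeasure_stdComplexGaussian : IsProbabilityMeasure stdComplexGaussian := by
  unfold stdComplexGaussian
  refine Measure.isProbabilityMeasure_map ?_
  exact Complex.measurableEquivRealProd.symm.measurable.aemeasurable

lemma measurable_gain {L : ℕ} : Measurable (gain (L := L)) := by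
  unfold gain
  fun_prop

lemma gain_nonneg {L : ℕ} (z : Fin L → ℂ) : 0 ≤ gain z := by
  unfold gain
  positivity

instance isProbabilityMeasure_gainLaw (L : ℕ) : IsProbabilityMeasure (gainLaw L) :=
  Measure.isProbabilityMeasure_map measurable_gain.aemeasurable

lemma integral_Ioi_pow_mul_exp_neg_sq (m : ℕ) {a : ℝ} (ha : 0 ≤ a) :
    ∫ y in Set.Ioi a, y ^ (2 * (m + 1) - 1) * Real.exp (-y ^ 2) =
      (m.factorial : ℝ) / 2 * gammaTail (m + 1) (a ^ 2) := by
  have hd : ∀ y ∈ Set.Ici a, HasDerivAt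
      (fun y => -((m.factorial : ℝ) / 2 * gammaTail (m + 1) (y ^ 2)))
      (y ^ (2 * (m + 1) - 1) * Real.exp (-y ^ 2)) y := by
    intro y _
    have := ((hasDerivAt_gammaTail m (y ^ 2)).comp y (hasDerivAt_pow 2 y)).const_mul
      ((m.factorial : ℝ) / 2)
    refine this.neg.congr_deriv ?_
    have h2 : (m.factorial : ℝ) ≠ 0 := by positivity
    rw [show 2 * (m + 1) - 1 = 2 * m + 1 by omega, pow_succ y (2 * m), pow_mul]
    push_cast
    field_simp
  have ht : Tendsto (fun y : ℝ => -((m.factorial : ℝ) / 2 * gammaTail (m + 1) (y ^ 2))) atTop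
      (𝓝 0) := by
    simpa using (((tendsto_gammaTail_atTop (m + 1)).comp
      (tendsto_pow_atTop (two_ne_zero))).const_mul ((m.factorial : ℝ) / 2)).neg
  rw [integral_Ioi_of_hasDerivAt_of_nonneg' hd (fun y hy => ?_) ht]
  · ring
  · have : 0 ≤ y := ha.trans (le_of_lt hy)
    positivity

/-- Polar coordinates in real dimension `2 * (m + 1)`. The constant collects the volume of the unit
ball and powers of `π`; its value is never needed, since total mass one determines it later. -/
lemma exists_gainLaw_real_Ioi_eq (m : ℕ) : ∃ c : ℝ, ∀ x : ℝ,
    (gainLaw (m + 1)).real (Set.Ioi x) =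
      c * ∫ y in Set.Ioi (0 : ℝ), y ^ (2 * (m + 1) - 1) *
        ((Set.Ioi x).indicator (fun _ => Real.exp (-y ^ 2)) (y ^ 2)) := by
  let L := m + 1
  -- `Fin L → ℂ` carries the sup norm; the Euclidean norm, whose square is `gain`, lives on `PiLp
  -- 2`. Lebesgue measure is transported there as some Haar measure.
  let E := PiLp 2 (fun _ : Fin L => ℂ)
  let e : (Fin L → ℂ) ≃L[ℝ] E := (PiLp.continuousLinearEquiv 2 ℝ (fun _ : Fin L => ℂ)).symm
  let μ : Measure E := (volume : Measure (Fin L → ℂ)).map e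
  have : μ.IsAddHaarMeasure := e.isAddHaarMeasure_map volume
  have hdim : Module.finrank ℝ E = 2 * L := by
    rw [← e.toLinearEquiv.finrank_eq]
    simp [Module.finrank_pi_fintype, Complex.finrank_real_complex, mul_comm]
  have : Nontrivial E := Module.nontrivial_of_finrank_pos (R := ℝ) (by rw [hdim]; positivity)
  have hnorm : ∀ z, ‖e z‖ ^ 2 = gain z := fun z => by
    rw [PiLp.norm_sq_eq_of_L2]; rfl
  have hρ : Integrable (fun z : ℂ => Real.pi⁻¹ * Real.exp (-‖z‖ ^ 2)) volume := by
    refine ⟨by fun_prop, ?_⟩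
    rw [hasFiniteIntegral_iff_ofReal (ae_of_all _ fun z => by positivity)]
    have h1 : stdComplexGaussian Set.univ = 1 := measure_univ
    rw [stdComplexGaussian_eq_withDensity, withDensity_apply _ .univ, setLIntegral_univ] at h1
    rw [h1]; exact ENNReal.one_lt_top
  refine ⟨Real.pi⁻¹ ^ L * (Module.finrank ℝ E * μ.real (Metric.ball 0 1)), fun x => ?_⟩
  have hms : MeasurableSet (gain (L := L) ⁻¹' Set.Ioi x) := measurable_gain measurableSet_Ioi
  have hprod : ∀ z : Fin L → ℂ, ∏ i, (Real.pi⁻¹ * Real.exp (-‖z i‖ ^ 2)) =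
      Real.pi⁻¹ ^ L * Real.exp (-gain z) := fun z => by
    rw [Finset.prod_mul_distrib, ← Real.exp_sum]
    simp [gain, Finset.sum_neg_distrib]
  have hfun : ∀ z : Fin L → ℂ, (gain (L := L) ⁻¹' Set.Ioi x).indicator
      (fun z => ∏ i, (Real.pi⁻¹ * Real.exp (-‖z i‖ ^ 2))) z =
      Real.pi⁻¹ ^ L * (fun y : ℝ => (Set.Ioi x).indicator
        (fun _ => Real.exp (-y ^ 2)) (y ^ 2)) ‖e z‖ := fun z => by
    beta_reduce
    rw [hnorm z]
    by_cases hz : x < gain z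
    · simp [Set.indicator, hz, hprod]
    · simp [Set.indicator, hz]
  have hint : Integrable (fun z : Fin L → ℂ => ∏ i, (Real.pi⁻¹ * Real.exp (-‖z i‖ ^ 2))) volume :=
    Integrable.fintype_prod (fun _ => hρ)
  have h1 : (gainLaw L).real (Set.Ioi x) = ∫ z : Fin L → ℂ, (gain (L := L) ⁻¹' Set.Ioi x).indicator
      (fun z => ∏ i, (Real.pi⁻¹ * Real.exp (-‖z i‖ ^ 2))) z := by
    rw [gainLaw, Measure.real, Measure.map_apply measurable_gain measurableSet_Ioi,
      stdComplexGaussian_eq_withDensity, pi_withDensity_ofReal _ _ (fun z => by positivity) hρ,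
      withDensity_apply _ hms, integral_indicator hms,
      integral_eq_lintegral_of_nonneg_ae (ae_of_all _ fun z => by positivity)
        hint.aestronglyMeasurable.restrict]
    rfl
  rw [h1]
  simp_rw [hfun]
  rw [integral_const_mul]
  have h2 := integral_fun_norm_addHaar μ
    (fun y : ℝ => (Set.Ioi x).indicator (fun _ => Real.exp (-y ^ 2)) (y ^ 2))
  have h3 : ∀ f : E → ℝ, ∫ z, f z ∂μ = ∫ z, f (e z) := fun f =>
    e.toHomeomorph.measurableEmbedding.integral_map f
  rw [h3] at h2
  simp only [hdim, nsmul_eq_mul, smul_eq_mul] at h2 ⊢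
  rw [mul_assoc]
  congr 1
  rw [mul_assoc]
  exact h2

lemma gainLaw_real_Ioi {L : ℕ} (hL : 1 ≤ L) {x : ℝ} (hx : 0 ≤ x) :
    (gainLaw L).real (Set.Ioi x) = gammaTail L x := by
  obtain ⟨m, rfl⟩ := Nat.exists_eq_add_of_le' hL
  obtain ⟨c, hc⟩ := exists_gainLaw_real_Ioi_eq m
  -- The gain is nonnegative, so the threshold `-1` captures all the mass and fixes `c`.
  have hneg : (gainLaw (m + 1)).real (Set.Ioi (-1)) = 1 := by
    rw [Measure.real, gainLaw, Measure.map_apply measurable_gain measurableSet_Ioi]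
    rw [show gain ⁻¹' Set.Ioi (-1) = Set.univ from ?_]
    · simp
    · exact Set.eq_univ_of_forall fun z => lt_of_lt_of_le (by norm_num) (gain_nonneg z)
  have h1 : ∫ y in Set.Ioi (0 : ℝ), y ^ (2 * (m + 1) - 1) *
        ((Set.Ioi (-1 : ℝ)).indicator (fun _ => Real.exp (-y ^ 2)) (y ^ 2)) =
        (m.factorial : ℝ) / 2 := by
    have h0 := integral_Ioi_pow_mul_exp_neg_sq m (le_refl 0)
    rw [zero_pow two_ne_zero, gammaTail_zero_right hL, mul_one] at h0
    rw [← h0]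
    refine setIntegral_congr_fun measurableSet_Ioi fun y _ => ?_
    have : (-1 : ℝ) < y ^ 2 := by nlinarith
    simp [this]
  have h2 : ∫ y in Set.Ioi (0 : ℝ), y ^ (2 * (m + 1) - 1) *
        ((Set.Ioi x).indicator (fun _ => Real.exp (-y ^ 2)) (y ^ 2)) =
        (m.factorial : ℝ) / 2 * gammaTail (m + 1) x := by
    have hs : Set.Ioi √x = Set.Ioi 0 ∩ Set.Ioi √x := by
      rw [Set.inter_eq_right.2]
      exact Set.Ioi_subset_Ioi (Real.sqrt_nonneg x)
    nth_rewrite 2 [← Real.sq_sqrt hx]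
    rw [← integral_Ioi_pow_mul_exp_neg_sq m (Real.sqrt_nonneg x), hs,
      ← setIntegral_indicator measurableSet_Ioi]
    refine setIntegral_congr_fun measurableSet_Ioi fun y hy => ?_
    by_cases h : √x < y
    · have h' : x < y ^ 2 := (Real.sqrt_lt hx (le_of_lt hy)).1 h
      simp [h, h']
    · have h' : ¬ x < y ^ 2 := fun h' => h ((Real.sqrt_lt hx (le_of_lt hy)).2 h')
      simp [h, h']
  have h3 := hc (-1)
  rw [hneg, h1] at h3
  rw [hc x, h2, ← mul_assoc, ← h3, one_mul]

lemma one_sub_cdf_gainLaw {L : ℕ} (hL : 1 ≤ L) {x : ℝ} (hx : 0 ≤ x) :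
    1 - cdf (gainLaw L) x = gammaTail L x := by
  rw [cdf_eq_real, ← gainLaw_real_Ioi hL hx, ← Set.compl_Iic, probReal_compl_eq_one_sub measurableSet_Iic]

lemma one_sub_cdf_gainLaw_of_neg (L : ℕ) {x : ℝ} (hx : x < 0) :
    1 - cdf (gainLaw L) x = 1 := by
  rw [cdf_eq_real, Measure.real, gainLaw, Measure.map_apply measurable_gain measurableSet_Iic,
    show gain ⁻¹' Set.Iic x = ∅ from ?_]
  · simp
  · refine Set.eq_empty_of_forall_notMem fun z hz => ?_
    exact absurd (gain_nonneg z) (not_le.2 (lt_of_le_of_lt hz hx))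

/-! ### Order statistics of an i.i.d. sample -/

lemma orderStat_eq {n : ℕ} (x : Fin n → ℝ) {k : ℕ} (hk : 1 ≤ k) (hkn : k ≤ n) :
    orderStat x (n - k + 1) = x (Tuple.sort x ⟨n - k, by omega⟩) := by
  rw [orderStat, dif_pos ⟨by omega, by omega⟩]
  rfl

/-- Sorting is a permutation, so it preserves the number of entries at most `t`; everything about
order statistics reduces to counting exceedances. -/
lemma lt_orderStat_iff {n : ℕ} (x : Fin n → ℝ) {k : ℕ} (hk : 1 ≤ k) (hkn : k ≤ n) (t : ℝ) :
    t < orderStat x (n - k + 1) ↔ k ≤ (Finset.univ.filter fun i => t < x i).card := by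
  have h1 := Tuple.lt_card_le_iff_apply_le_of_monotone (j := ⟨n - k, by omega⟩) (a := t)
    (Tuple.monotone_sort x)
  have h2 : (Finset.univ.filter fun i => (x ∘ Tuple.sort x) i ≤ t).card =
      (Finset.univ.filter fun i => x i ≤ t).card :=
    Finset.card_equiv (Tuple.sort x) (by simp)
  have h3 : (Finset.univ.filter fun i => x i ≤ t).card +
      (Finset.univ.filter fun i => t < x i).card = n := by
    have := Finset.card_filter_add_card_filter_not (s := (Finset.univ : Finset (Fin n)))
      (fun i => x i ≤ t)
    simpa using this
  rw [orderStat_eq x hk hkn, ← not_le]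
  rw [h2] at h1
  change ¬ (x ∘ Tuple.sort x) ⟨n - k, _⟩ ≤ t ↔ _
  rw [← h1]
  simp only
  omega

lemma measurable_orderStat {n k : ℕ} (hk : 1 ≤ k) (hkn : k ≤ n) :
    Measurable (fun x : Fin n → ℝ => orderStat x (n - k + 1)) := by
  refine measurable_of_Ioi fun t => ?_
  have : (fun x : Fin n → ℝ => orderStat x (n - k + 1)) ⁻¹' Set.Ioi t =
      {x | (k : ℝ) ≤ ∑ i, (Set.Ioi t).indicator (fun _ => (1 : ℝ)) (x i)} := by
    ext x
    simp only [Set.mem_preimage, Set.mem_Ioi, lt_orderStat_iff x hk hkn, Set.mem_ofPred_eq,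
      Set.indicator_apply]
    rw [Finset.sum_boole]
    norm_cast
  rw [this]
  refine measurableSet_le measurable_const (Finset.measurable_sum _ fun i _ => ?_)
  exact (measurable_const.indicator measurableSet_Ioi).comp (measurable_pi_apply i)

/-- The probability that a binomial variable is at least `k`. -/
noncomputable def binomTail (n k : ℕ) (p : ℝ) : ℝ :=
  1 - ∑ j ∈ Finset.range k, n.choose j * p ^ j * (1 - p) ^ (n - j)

section iid

variable {n : ℕ} (μ : Measure ℝ) [IsProbabilityMeasure μ]

/-- Prescribing exactly which coordinates exceed `t` cuts out a box, whose product measure is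
explicit; summing over index sets of size `j` gives the binomial law. -/
lemma setOf_filter_lt_eq (t : ℝ) (s : Finset (Fin n)) :
    {x : Fin n → ℝ | (Finset.univ.filter fun i => t < x i) = s} =
      Set.univ.pi (fun i => if i ∈ s then Set.Ioi t else Set.Iic t) := by
  ext x
  simp only [Set.mem_ofPred_eq, Set.mem_univ_pi, Finset.ext_iff, Finset.mem_filter,
    Finset.mem_univ, true_and]
  refine forall_congr' fun i => ?_
  by_cases hi : i ∈ s <;> simp [hi]

lemma measurableSet_filter_lt_eq (t : ℝ) (s : Finset (Fin n)) :
    MeasurableSet {x : Fin n → ℝ | (Finset.univ.filter fun i => t < x i) = s} := by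
  rw [setOf_filter_lt_eq]
  refine MeasurableSet.univ_pi fun i => ?_
  split_ifs
  exacts [measurableSet_Ioi, measurableSet_Iic]

lemma pi_real_filter_lt_eq (t : ℝ) (s : Finset (Fin n)) :
    (Measure.pi fun _ : Fin n => μ).real
      {x | (Finset.univ.filter fun i => t < x i) = s} =
      μ.real (Set.Ioi t) ^ s.card * (1 - μ.real (Set.Ioi t)) ^ (n - s.card) := by
  rw [setOf_filter_lt_eq, Measure.real, Measure.pi_pi, ENNReal.toReal_prod]
  have h1 : ∀ i, (μ (if i ∈ s then Set.Ioi t else Set.Iic t)).toReal =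
      if i ∈ s then μ.real (Set.Ioi t) else 1 - μ.real (Set.Ioi t) := by
    intro i
    split_ifs
    · rfl
    · rw [← probReal_compl_eq_one_sub measurableSet_Ioi, Set.compl_Ioi]; rfl
  simp_rw [h1]
  rw [Finset.prod_ite, Finset.prod_const, Finset.prod_const]
  congr 2
  · simp
  · have := Finset.card_filter_add_card_filter_not (s := (Finset.univ : Finset (Fin n)))
      (fun i => i ∈ s)
    have h2 : (Finset.univ.filter fun i => i ∈ s) = s := by simp
    rw [h2] at this
    simp only [Finset.card_univ, Fintype.card_fin] at this
    omega

lemma pi_real_card_filter_lt_eq (t : ℝ) (j : ℕ) :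
    (Measure.pi fun _ : Fin n => μ).real
      {x | (Finset.univ.filter fun i => t < x i).card = j} =
      n.choose j * μ.real (Set.Ioi t) ^ j * (1 - μ.real (Set.Ioi t)) ^ (n - j) := by
  have : {x : Fin n → ℝ | (Finset.univ.filter fun i => t < x i).card = j} =
      ⋃ s ∈ Finset.powersetCard j (Finset.univ : Finset (Fin n)),
        {x | (Finset.univ.filter fun i => t < x i) = s} := by
    ext x; simp
  rw [this, measureReal_biUnion_finset]
  · rw [Finset.sum_congr rfl fun s hs => ?_, Finset.sum_const, Finset.card_powersetCard,
      Finset.card_univ, Fintype.card_fin, nsmul_eq_mul, ← mul_assoc]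
    rw [pi_real_filter_lt_eq, (Finset.mem_powersetCard.1 hs).2]
  · intro s _ s' _ hss'
    refine Set.disjoint_left.2 fun x hx hx' => hss' ?_
    exact hx.symm.trans hx'
  · exact fun s _ => measurableSet_filter_lt_eq t s

lemma measurableSet_card_filter_lt_eq (t : ℝ) (j : ℕ) :
    MeasurableSet {x : Fin n → ℝ | (Finset.univ.filter fun i => t < x i).card = j} := by
  have : {x : Fin n → ℝ | (Finset.univ.filter fun i => t < x i).card = j} =
      ⋃ s ∈ Finset.powersetCard j (Finset.univ : Finset (Fin n)),
        {x | (Finset.univ.filter fun i => t < x i) = s} := by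
    ext x; simp
  rw [this]
  exact Finset.measurableSet_biUnion _ fun s _ => measurableSet_filter_lt_eq t s

lemma pi_real_lt_orderStat {k : ℕ} (hk : 1 ≤ k) (hkn : k ≤ n) (t : ℝ) :
    (Measure.pi fun _ : Fin n => μ).real {x | t < orderStat x (n - k + 1)} =
      binomTail n k (μ.real (Set.Ioi t)) := by
  have h1 : {x : Fin n → ℝ | t < orderStat x (n - k + 1)} =
      (⋃ j ∈ Finset.range k, {x | (Finset.univ.filter fun i => t < x i).card = j})ᶜ := by
    ext x
    simp only [Set.mem_ofPred_eq, lt_orderStat_iff x hk hkn, Set.mem_compl_iff, Set.mem_iUnion,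
      Finset.mem_range, exists_prop, not_exists, not_and]
    exact ⟨fun h i hi he => absurd h (by omega), fun h => not_lt.1 fun hlt => h _ hlt rfl⟩
  have hm : ∀ j ∈ Finset.range k,
      MeasurableSet {x : Fin n → ℝ | (Finset.univ.filter fun i => t < x i).card = j} :=
    fun j _ => measurableSet_card_filter_lt_eq t j
  rw [h1, probReal_compl_eq_one_sub (Finset.measurableSet_biUnion _ hm), binomTail,
    measureReal_biUnion_finset _ hm]
  · simp_rw [pi_real_card_filter_lt_eq]
  · intro s _ s' _ hss'
    refine Set.disjoint_left.2 fun x hx hx' => hss' ?_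
    exact hx.symm.trans hx'

variable {μ}

lemma ae_pi_nonneg (hμ0 : ∀ᵐ x ∂μ, 0 ≤ x) : ∀ᵐ x ∂(Measure.pi fun _ : Fin n => μ), ∀ i, 0 ≤ x i :=
  ae_all_iff.2 fun i => (Measure.quasiMeasurePreserving_eval (fun _ => μ) i).ae hμ0

lemma ae_pi_orderStat_nonneg (hμ0 : ∀ᵐ x ∂μ, 0 ≤ x) {k : ℕ} (hk : 1 ≤ k) (hkn : k ≤ n) :
    ∀ᵐ x ∂(Measure.pi fun _ : Fin n => μ), 0 ≤ orderStat x (n - k + 1) := by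
  filter_upwards [ae_pi_nonneg hμ0] with x hx
  rw [orderStat_eq x hk hkn]
  exact hx _

/-- For nonnegative samples every order statistic is dominated by the sum. -/
lemma integrable_orderStat (hμ0 : ∀ᵐ x ∂μ, 0 ≤ x)
    (hμi : Integrable (fun x : ℝ => x) μ) {k : ℕ} (hk : 1 ≤ k) (hkn : k ≤ n) :
    Integrable (fun x => orderStat x (n - k + 1)) (Measure.pi fun _ : Fin n => μ) := by
  have hs : Integrable (fun x => ∑ i, x i) (Measure.pi fun _ : Fin n => μ) :=
    integrable_finsetSum _ fun i _ => integrable_comp_eval (μ := fun _ => μ) (i := i) hμi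
  refine hs.mono' (measurable_orderStat hk hkn).aestronglyMeasurable ?_
  filter_upwards [ae_pi_nonneg hμ0] with x hx
  rw [orderStat_eq x hk hkn, Real.norm_of_nonneg (hx _)]
  exact Finset.single_le_sum (f := x) (fun i _ => hx i) (Finset.mem_univ _)

lemma integral_orderStat (hμ0 : ∀ᵐ x ∂μ, 0 ≤ x)
    (hμi : Integrable (fun x : ℝ => x) μ) {k : ℕ} (hk : 1 ≤ k) (hkn : k ≤ n) :
    ∫ x, orderStat x (n - k + 1) ∂(Measure.pi fun _ : Fin n => μ) =
      ∫ t in Set.Ioi (0 : ℝ), binomTail n k (μ.real (Set.Ioi t)) := by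
  rw [(integrable_orderStat hμ0 hμi hk hkn).integral_eq_integral_meas_lt
    (ae_pi_orderStat_nonneg hμ0 hk hkn)]
  simp_rw [pi_real_lt_orderStat μ hk hkn]

end iid

/-! ### Binomial tail estimates and the Poisson limit -/

section binomTail

variable {n : ℕ} {p : ℝ}

lemma sum_binomial_terms (n : ℕ) (p : ℝ) :
    ∑ i ∈ Finset.range (n + 1), n.choose i * p ^ i * (1 - p) ^ (n - i) = 1 := by
  have := (add_pow p (1 - p) n).symm
  rw [add_sub_cancel, one_pow] at this
  refine Eq.trans (Finset.sum_congr rfl fun i _ => ?_) this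
  ring

lemma binomial_term_nonneg (hp0 : 0 ≤ p) (hp1 : p ≤ 1) (j : ℕ) :
    0 ≤ n.choose j * p ^ j * (1 - p) ^ (n - j) := by
  have hq : 0 ≤ 1 - p := sub_nonneg.2 hp1
  positivity

lemma binomial_term_le_one (hp0 : 0 ≤ p) (hp1 : p ≤ 1) {j : ℕ} (hj : j ≤ n) :
    n.choose j * p ^ j * (1 - p) ^ (n - j) ≤ 1 := by
  refine le_of_le_of_eq ?_ (sum_binomial_terms n p)
  exact Finset.single_le_sum (f := fun i => n.choose i * p ^ i * (1 - p) ^ (n - i))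
    (fun i _ => binomial_term_nonneg hp0 hp1 i) (Finset.mem_range.2 (by omega))

/-- Since `(n + 1) * C(n, j) = (j + 1) * C(n + 1, j + 1)`, multiplying the term by `(n + 1) * p`
yields `j + 1` times a binomial probability for `n + 1` trials. -/
lemma binomial_term_mul_le (hp0 : 0 ≤ p) (hp1 : p ≤ 1) {j : ℕ} (hj : j ≤ n) :
    (n.choose j * p ^ j * (1 - p) ^ (n - j)) * ((n : ℝ) * p) ≤ j + 1 := by
  have h1 : ((n : ℝ) + 1) * n.choose j = (n + 1).choose (j + 1) * (j + 1) := by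
    exact_mod_cast Nat.add_one_mul_choose_eq n j
  have h2 := binomial_term_le_one (n := n + 1) hp0 hp1 (j := j + 1) (by omega)
  have h3 : (n.choose j * p ^ j * (1 - p) ^ (n - j)) * (((n : ℝ) + 1) * p) =
      ((n + 1).choose (j + 1) * p ^ (j + 1) * (1 - p) ^ (n + 1 - (j + 1))) * (j + 1) := by
    rw [show n + 1 - (j + 1) = n - j by omega]
    linear_combination p ^ (j + 1) * (1 - p) ^ (n - j) * h1
  calc _ ≤ (n.choose j * p ^ j * (1 - p) ^ (n - j)) * (((n : ℝ) + 1) * p) := by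
        refine mul_le_mul_of_nonneg_left ?_ (binomial_term_nonneg hp0 hp1 j)
        linarith
    _ ≤ 1 * ((j : ℝ) + 1) := by
        rw [h3]
        exact mul_le_mul_of_nonneg_right h2 (by positivity)
    _ = _ := one_mul _

lemma binomTail_le_one (hp0 : 0 ≤ p) (hp1 : p ≤ 1) (k : ℕ) : binomTail n k p ≤ 1 := by
  rw [binomTail, sub_le_self_iff]
  exact Finset.sum_nonneg fun j _ => binomial_term_nonneg hp0 hp1 j

lemma binomTail_nonneg (hp0 : 0 ≤ p) (hp1 : p ≤ 1) {k : ℕ} (hkn : k ≤ n) :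
    0 ≤ binomTail n k p := by
  rw [binomTail, sub_nonneg]
  refine le_of_le_of_eq ?_ (sum_binomial_terms n p)
  refine Finset.sum_le_sum_of_subset_of_nonneg ?_ fun j _ _ => binomial_term_nonneg hp0 hp1 j
  exact Finset.range_subset_range.2 (by omega)

/-- The term `j = 0` alone suffices, by Bernoulli's inequality. This controls the integrand to the
right of `a_n`. -/
lemma binomTail_le_mul (hp0 : 0 ≤ p) (hp1 : p ≤ 1) {k : ℕ} (hk : 1 ≤ k) :
    binomTail n k p ≤ n * p := by
  have h1 : (1 - p) ^ n ≤ ∑ j ∈ Finset.range k, n.choose j * p ^ j * (1 - p) ^ (n - j) := by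
    have := Finset.single_le_sum (f := fun j => n.choose j * p ^ j * (1 - p) ^ (n - j))
      (fun j _ => binomial_term_nonneg hp0 hp1 j) (Finset.mem_range.2 hk)
    simpa using this
  have h2 := one_add_mul_le_pow (a := -p) (by linarith) n
  rw [binomTail]
  rw [← sub_eq_add_neg] at h2
  linarith

/-- Each of the `k` terms contributes at most `j + 1 ≤ k`. This controls the integrand to the left
of `a_n`, where `n * p` is large. -/
lemma one_sub_binomTail_mul_le (hp0 : 0 ≤ p) (hp1 : p ≤ 1) {k : ℕ} (hkn : k ≤ n) :
    (1 - binomTail n k p) * (n * p) ≤ (k : ℝ) ^ 2 := by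
  rw [binomTail, sub_sub_cancel, Finset.sum_mul]
  calc _ ≤ ∑ j ∈ Finset.range k, (k : ℝ) := by
        refine Finset.sum_le_sum fun j hj => ?_
        have hjk := Finset.mem_range.1 hj
        refine (binomial_term_mul_le hp0 hp1 (by omega)).trans ?_
        exact_mod_cast hjk
    _ = _ := by simp [sq]

end binomTail

/-- The probability that a Poisson variable with mean `r` is at least `k`. -/
noncomputable def poissonTail (k : ℕ) (r : ℝ) : ℝ :=
  1 - ∑ j ∈ Finset.range k, Real.exp (-r) * r ^ j / (j.factorial : ℝ)

lemma tendsto_binomTail {p : ℕ → ℝ} {r : ℝ} (k : ℕ)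
    (h : Tendsto (fun n : ℕ => n * p n) atTop (𝓝 r)) :
    Tendsto (fun n => binomTail n k (p n)) atTop (𝓝 (poissonTail k r)) := by
  unfold binomTail poissonTail
  exact tendsto_const_nhds.sub (tendsto_finsetSum _ fun j _ =>
    tendsto_choose_mul_pow_of_tendsto_mul_atTop j h)

/-! ### Asymptotics and submultiplicativity of the Gamma tail -/

section gammaTail

variable {L : ℕ}

/-- By the binomial theorem the left sum consists of the products `x^i/i! * u^j/j!` with `i + j <
L`, a subset of the nonnegative terms of the product on the right. -/
lemma gammaTail_add_le (L : ℕ) {x u : ℝ} (hx : 0 ≤ x) (hu : 0 ≤ u) :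
    gammaTail L (x + u) ≤ gammaTail L x * gammaTail L u := by
  have h1 : ∑ m ∈ Finset.range L, (x + u) ^ m / (m.factorial : ℝ) ≤
      (∑ i ∈ Finset.range L, x ^ i / (i.factorial : ℝ)) *
        ∑ i ∈ Finset.range L, u ^ i / (i.factorial : ℝ) := by
    calc _ = ∑ m ∈ Finset.range L, ∑ i ∈ Finset.range (m + 1),
          (x ^ i / (i.factorial : ℝ)) * (u ^ (m - i) / ((m - i).factorial : ℝ)) := by
          refine Finset.sum_congr rfl fun m _ => ?_
          rw [add_pow, Finset.sum_div]
          refine Finset.sum_congr rfl fun i hi => ?_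
          rw [Nat.cast_choose ℝ (Nat.lt_succ_iff.1 (Finset.mem_range.1 hi))]
          have : (m.factorial : ℝ) ≠ 0 := by positivity
          field_simp
      _ = ∑ i ∈ Finset.range L, ∑ j ∈ Finset.range (L - i),
          (x ^ i / (i.factorial : ℝ)) * (u ^ j / (j.factorial : ℝ)) :=
          Finset.sum_range_diag_flip L fun i j =>
            (x ^ i / (i.factorial : ℝ)) * (u ^ j / (j.factorial : ℝ))
      _ ≤ ∑ i ∈ Finset.range L, ∑ j ∈ Finset.range L,
          (x ^ i / (i.factorial : ℝ)) * (u ^ j / (j.factorial : ℝ)) := by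
          refine Finset.sum_le_sum fun i _ => ?_
          refine Finset.sum_le_sum_of_subset_of_nonneg ?_ fun j _ _ => by positivity
          exact Finset.range_subset_range.2 (Nat.sub_le _ _)
      _ = _ := by rw [Finset.sum_mul_sum]
  unfold gammaTail
  rw [neg_add, Real.exp_add, mul_mul_mul_comm]
  gcongr

lemma gammaTail_pos (hL : 1 ≤ L) {x : ℝ} (hx : 0 ≤ x) : 0 < gammaTail L x := by
  obtain ⟨m, rfl⟩ := Nat.exists_eq_add_of_le' hL
  unfold gammaTail
  refine mul_pos (Real.exp_pos _) ?_
  rw [Finset.sum_range_succ']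
  have : 0 ≤ ∑ k ∈ Finset.range m, x ^ (k + 1) / ((k + 1).factorial : ℝ) := by positivity
  simp only [pow_zero, Nat.factorial_zero, Nat.cast_one, div_one]
  linarith

lemma antitoneOn_gammaTail (hL : 1 ≤ L) : AntitoneOn (gammaTail L) (Set.Ici 0) := by
  obtain ⟨m, rfl⟩ := Nat.exists_eq_add_of_le' hL
  refine antitoneOn_of_deriv_nonpos (convex_Ici 0) (continuous_gammaTail _).continuousOn
    (fun x _ => (hasDerivAt_gammaTail m x).differentiableAt.differentiableWithinAt) fun x hx => ?_
  rw [interior_Ici] at hx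
  have : 0 < x := hx
  rw [(hasDerivAt_gammaTail m x).deriv]
  have : 0 ≤ Real.exp (-x) * (x ^ m / (m.factorial : ℝ)) := by positivity
  linarith

lemma gammaTail_le_one (hL : 1 ≤ L) {x : ℝ} (hx : 0 ≤ x) : gammaTail L x ≤ 1 := by
  rw [← gammaTail_zero_right hL]
  exact antitoneOn_gammaTail hL Set.self_mem_Ici hx hx

lemma integrableOn_gammaTail (L : ℕ) : IntegrableOn (gammaTail L) (Set.Ioi 0) := by
  have : gammaTail L = fun x => ∑ i ∈ Finset.range L,
      (Real.exp (-x) * x ^ ((i + 1 : ℝ) - 1)) / (i.factorial : ℝ) := by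
    ext x
    rw [gammaTail, Finset.mul_sum]
    exact Finset.sum_congr rfl fun i _ => by rw [add_sub_cancel_right, Real.rpow_natCast]; ring
  rw [this]
  exact integrable_finsetSum _ fun i _ =>
    (Real.GammaIntegral_convergent (by positivity)).div_const _

lemma integrable_comp_abs {f : ℝ → ℝ} (hf : IntegrableOn f (Set.Ioi 0)) :
    Integrable (fun x => f |x|) := by
  have h1 : IntegrableOn (fun x => f |x|) (Set.Ioi 0) :=
    hf.congr_fun (fun x hx => by rw [abs_of_pos hx]) measurableSet_Ioi
  have h2 : IntegrableOn (fun x => f |x|) (Set.Iic 0) := by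
    have h3 : IntegrableOn (fun x => f |x|) (Set.Ici (-0)) := by
      rw [neg_zero]
      exact Iff.mpr integrableOn_Ici_iff_integrableOn_Ioi h1
    simpa using h3.comp_neg_Iic
  rw [← integrableOn_univ, ← Set.Iic_union_Ioi (a := (0 : ℝ))]
  exact h2.union h1

/-- A polynomial of degree less than `m + 1`, shifted by `u` and divided by `x ^ m`, tends to its
coefficient of degree `m`. -/
lemma tendsto_sum_mul_add_pow_div_pow (m : ℕ) (c : ℕ → ℝ) (u : ℝ) :
    Tendsto (fun x : ℝ => (∑ i ∈ Finset.range (m + 1), c i * (x + u) ^ i) / x ^ m) atTop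
      (𝓝 (c m)) := by
  have h1 : Tendsto (fun x : ℝ => (x + u) / x) atTop (𝓝 1) := by
    have : Tendsto (fun x : ℝ => 1 + u / x) atTop (𝓝 (1 + 0)) :=
      tendsto_const_nhds.add (tendsto_const_nhds.div_atTop tendsto_id)
    rw [add_zero] at this
    refine this.congr' ?_
    filter_upwards [eventually_ne_atTop 0] with x hx
    field_simp
  have h2 : ∀ i ∈ Finset.range (m + 1), Tendsto (fun x : ℝ => c i * (x + u) ^ i / x ^ m) atTop
      (𝓝 (if i = m then c i else 0)) := by
    intro i hi
    have him := Nat.lt_succ_iff.1 (Finset.mem_range.1 hi)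
    have h3 : Tendsto (fun x : ℝ => c i * ((x + u) / x) ^ i * (1 / x ^ (m - i))) atTop
        (𝓝 (c i * 1 ^ i * (if i = m then 1 else 0))) := by
      refine ((h1.pow i).const_mul _).mul ?_
      split_ifs with h
      · subst h; simp
      · exact tendsto_const_nhds.div_atTop (tendsto_pow_atTop (by omega))
    rw [one_pow, mul_one, mul_ite, mul_one, mul_zero] at h3
    refine h3.congr' ?_
    filter_upwards [eventually_ne_atTop 0] with x hx
    rw [div_pow, ← pow_sub_mul_pow x him]
    field_simp
  have h4 := tendsto_finsetSum _ h2
  simp only [Finset.sum_ite_eq', Finset.mem_range, Nat.lt_succ_self, if_true] at h4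
  refine h4.congr fun x => ?_
  rw [Finset.sum_div]

/-- The two polynomial factors have the same leading term, so only the ratio of exponentials
survives. This places the law in the Gumbel domain of attraction with scale `1`. -/
lemma tendsto_gammaTail_add_div (hL : 1 ≤ L) (u : ℝ) :
    Tendsto (fun x => gammaTail L (x + u) / gammaTail L x) atTop (𝓝 (Real.exp (-u))) := by
  obtain ⟨m, rfl⟩ := Nat.exists_eq_add_of_le' hL
  have h := fun u => tendsto_sum_mul_add_pow_div_pow m (fun i => 1 / (i.factorial : ℝ)) u
  have h1 := ((h u).div (h 0) (by positivity)).const_mul (Real.exp (-u))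
  rw [div_self (by positivity), mul_one] at h1
  refine h1.congr' ?_
  filter_upwards [eventually_gt_atTop 0] with x hx
  simp only [add_zero, Pi.div_apply, one_div_mul_eq_div]
  rw [div_div_div_cancel_right₀ (by positivity), gammaTail, gammaTail, neg_add_rev, Real.exp_add]
  field_simp

end gammaTail

/-! ### The normalising sequences -/

section aSeq

variable {L n : ℕ}

/-- By continuity the infimum is attained and the tail there equals `1/n`. For `n = 1` the defining
set is all of `ℝ`, hence the assumption `2 ≤ n`. -/
lemma aSeq_spec (hL : 1 ≤ L) (hn : 2 ≤ n) :
    0 ≤ aSeq L n ∧ gammaTail L (aSeq L n) = 1 / n := by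
  have hn' : (2 : ℝ) ≤ n := by exact_mod_cast hn
  have hlt : 1 / (n : ℝ) < 1 := by
    rw [div_lt_one (by linarith)]; linarith
  have hpos : 0 < 1 / (n : ℝ) := by positivity
  have hset : {x : ℝ | 1 - cdf (gainLaw L) x ≤ 1 / (n : ℝ)} =
      Set.Ici 0 ∩ gammaTail L ⁻¹' Set.Iic (1 / (n : ℝ)) := by
    ext x
    rcases lt_or_ge x 0 with hx | hx
    · rw [Set.mem_ofPred_eq, one_sub_cdf_gainLaw_of_neg L hx]
      exact ⟨fun h => absurd h (not_le.2 hlt), fun h => absurd h.1 (not_le.2 hx)⟩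
    · rw [Set.mem_ofPred_eq, one_sub_cdf_gainLaw hL hx]
      exact ⟨fun h => ⟨hx, h⟩, fun h => h.2⟩
  obtain ⟨y, hy0, hy⟩ : ∃ y, 0 ≤ y ∧ gammaTail L y = 1 / (n : ℝ) := by
    obtain ⟨M, hM0, hM⟩ := ((eventually_ge_atTop (0 : ℝ)).and
      ((tendsto_gammaTail_atTop L).eventually (gt_mem_nhds hpos))).exists
    have := intermediate_value_Icc' hM0 (continuous_gammaTail L).continuousOn
      ⟨hM.le, by rw [gammaTail_zero_right hL]; exact hlt.le⟩
    exact ⟨this.choose, this.choose_spec.1.1, this.choose_spec.2⟩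
  have hbdd : BddBelow (Set.Ici 0 ∩ gammaTail L ⁻¹' Set.Iic (1 / (n : ℝ))) :=
    ⟨0, fun x hx => hx.1⟩
  have hymem : y ∈ Set.Ici 0 ∩ gammaTail L ⁻¹' Set.Iic (1 / (n : ℝ)) := ⟨hy0, hy.le⟩
  have hmem : aSeq L n ∈ Set.Ici 0 ∩ gammaTail L ⁻¹' Set.Iic (1 / (n : ℝ)) := by
    rw [aSeq, hset]
    exact (isClosed_Ici.inter (isClosed_Iic.preimage (continuous_gammaTail L))).csInf_mem
      ⟨y, hymem⟩ hbdd
  have hle : aSeq L n ≤ y := by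
    rw [aSeq, hset]
    exact csInf_le hbdd hymem
  exact ⟨hmem.1, le_antisymm hmem.2 (hy ▸ antitoneOn_gammaTail hL hmem.1 hy0 hle)⟩

lemma tendsto_aSeq (hL : 1 ≤ L) : Tendsto (aSeq L) atTop atTop := by
  refine tendsto_atTop.2 fun M => ?_
  have hM : 0 ≤ max M 0 := le_max_right _ _
  filter_upwards [eventually_ge_atTop 2, tendsto_one_div_atTop_nhds_zero_nat.eventually
    (gt_mem_nhds (gammaTail_pos hL hM))] with n hn hlt
  obtain ⟨h0, h1⟩ := aSeq_spec hL hn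
  refine (le_max_left M 0).trans (le_of_lt (not_le.1 fun hle => ?_))
  have := antitoneOn_gammaTail hL h0 hM hle
  linarith

/-- With `L = m + 1`, the coefficients of `a_n ^ m` in numerator and denominator are both `1/m!`. -/
lemma tendsto_bSeq (hL : 1 ≤ L) : Tendsto (bSeq L) atTop (𝓝 1) := by
  obtain ⟨m, rfl⟩ := Nat.exists_eq_add_of_le' hL
  have h1 := tendsto_sum_mul_add_pow_div_pow m
    (fun i => (((m + 1 : ℕ) : ℝ) - i) / (i.factorial : ℝ)) 0
  have h2 := tendsto_sum_mul_add_pow_div_pow m (fun i => 1 / (i.factorial : ℝ)) 0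
  have h3 := (h1.div h2 (by positivity)).comp (tendsto_aSeq hL)
  have h4 : (((m + 1 : ℕ) : ℝ) - m) / (m.factorial : ℝ) / (1 / (m.factorial : ℝ)) = 1 := by
    have : (m.factorial : ℝ) ≠ 0 := by positivity
    push_cast; field_simp; ring
  rw [h4] at h3
  refine h3.congr' ?_
  filter_upwards [(tendsto_aSeq hL).eventually_gt_atTop 0] with n hn
  simp only [Function.comp_apply, add_zero, Pi.div_apply]
  rw [div_div_div_cancel_right₀ (by positivity), bSeq]

end aSeq

/-! ### The Gumbel mean and the limiting integrals -/

section Gumbel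

/-- Differentiating the Mellin transform of `e^{-t}`, which is `Γ`, under the integral sign brings
out `log t`; at `1` this identifies the integral of `log t * e^{-t}` with `Γ'(1) = -γ`. -/
lemma mellinConvergent_log_mul_exp_neg_and_hasDerivAt :
    MellinConvergent (fun t : ℝ => Real.log t • (Real.exp (-t) : ℂ)) 1 ∧
      HasDerivAt (mellin fun t : ℝ => (Real.exp (-t) : ℂ))
        (mellin (fun t : ℝ => Real.log t • (Real.exp (-t) : ℂ)) 1) 1 := by
  -- Any exponents with `b < 1 < a` would do: `e^{-t}` is bounded near `0` and decays faster than
  -- every power at infinity.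
  refine mellin_hasDerivAt_of_isBigO_rpow (a := 2) (b := 0) ?_ ?_ (by simp) ?_ (by simp)
  · exact (Continuous.locallyIntegrable (by fun_prop)).locallyIntegrableOn _
  · rw [← Asymptotics.isBigO_norm_left]
    simp_rw [Complex.norm_real, Asymptotics.isBigO_norm_left]
    have := (isLittleO_exp_neg_mul_rpow_atTop one_pos (-2)).isBigO
    simpa using this
  · simp only [neg_zero, Real.rpow_zero]
    refine (Continuous.tendsto (by fun_prop) 0 |>.mono_left nhdsWithin_le_nhds).isBigO_one ℝ

lemma integrableOn_log_mul_exp_neg :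
    IntegrableOn (fun t : ℝ => Real.log t * Real.exp (-t)) (Set.Ioi 0) := by
  have h := mellinConvergent_log_mul_exp_neg_and_hasDerivAt.1
  rw [MellinConvergent] at h
  refine h.re.congr ?_
  refine ae_of_all _ fun t => ?_
  beta_reduce
  rw [sub_self, Complex.cpow_zero, one_smul, Complex.real_smul, ← Complex.ofReal_mul]
  exact Complex.ofReal_re _

lemma integral_log_mul_exp_neg :
    ∫ t in Set.Ioi (0 : ℝ), Real.log t * Real.exp (-t) = -Real.eulerMascheroniConstant := by
  have h := mellinConvergent_log_mul_exp_neg_and_hasDerivAt.2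
  have h1 : (mellin fun t : ℝ => (Real.exp (-t) : ℂ)) =ᶠ[𝓝 1] Complex.Gamma := by
    have : {z : ℂ | 0 < z.re} ∈ 𝓝 (1 : ℂ) :=
      (isOpen_lt continuous_const Complex.continuous_re).mem_nhds (by simp)
    filter_upwards [this] with z hz
    rw [Complex.Gamma_eq_integral hz, Complex.GammaIntegral_eq_mellin]
  have h2 := (h.congr_of_eventuallyEq h1.symm).unique Complex.hasDerivAt_Gamma_one
  have h3 : mellin (fun t : ℝ => Real.log t • (Real.exp (-t) : ℂ)) 1 =
      ((∫ t in Set.Ioi (0 : ℝ), Real.log t * Real.exp (-t) : ℝ) : ℂ) := by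
    rw [mellin, ← integral_complex_ofReal]
    refine integral_congr_ae (ae_of_all _ fun t => ?_)
    simp
  rw [h3] at h2
  exact_mod_cast h2

lemma gumbelCDF_apply (x : ℝ) : gumbelCDF x = Real.exp (-Real.exp (-x)) := rfl

lemma tendsto_gumbelCDF_atBot : Tendsto gumbelCDF atBot (𝓝 0) :=
  Real.tendsto_exp_neg_atTop_nhds_zero.comp (Real.tendsto_exp_atTop.comp tendsto_neg_atBot_atTop)

lemma tendsto_gumbelCDF_atTop : Tendsto gumbelCDF atTop (𝓝 1) := by
  have h : Tendsto (fun x : ℝ => Real.exp (-Real.exp (-x))) atTop (𝓝 (Real.exp (-0))) :=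
    (Real.continuous_exp.tendsto _).comp (Real.tendsto_exp_neg_atTop_nhds_zero.neg)
  rw [neg_zero, Real.exp_zero] at h
  exact h

instance isProbabilityMeasure_gumbel : IsProbabilityMeasure gumbelCDF.measure :=
  gumbelCDF.isProbabilityMeasure tendsto_gumbelCDF_atBot tendsto_gumbelCDF_atTop

lemma gumbel_Iic (x : ℝ) :
    gumbelCDF.measure (Set.Iic x) = ENNReal.ofReal (Real.exp (-Real.exp (-x))) := by
  rw [gumbelCDF.measure_Iic tendsto_gumbelCDF_atBot, sub_zero, gumbelCDF_apply]

lemma gumbel_real_Iic (x : ℝ) : gumbelCDF.measure.real (Set.Iic x) = Real.exp (-Real.exp (-x)) := by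
  rw [Measure.real, gumbel_Iic, ENNReal.toReal_ofReal (Real.exp_pos _).le]

lemma gumbel_real_Ioi (x : ℝ) :
    gumbelCDF.measure.real (Set.Ioi x) = 1 - Real.exp (-Real.exp (-x)) := by
  rw [← Set.compl_Iic, probReal_compl_eq_one_sub measurableSet_Iic, gumbel_real_Iic]

/-- The Gumbel law is the law of `-log t` for `t` exponentially distributed. -/
lemma gumbel_eq_map_neg_log :
    gumbelCDF.measure = ((volume.restrict (Set.Ioi (0 : ℝ))).withDensity
      (fun t => ENNReal.ofReal (Real.exp (-t)))).map (fun t => -Real.log t) := by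
  refine Measure.ext_of_Iic _ _ fun x => ?_
  have hm : Measurable (fun t : ℝ => -Real.log t) := Real.measurable_log.neg
  have hs : (fun t : ℝ => -Real.log t) ⁻¹' Set.Iic x ∩ Set.Ioi 0 = Set.Ici (Real.exp (-x)) := by
    ext t
    simp only [Set.mem_inter_iff, Set.mem_preimage, Set.mem_Iic, Set.mem_Ioi, Set.mem_Ici]
    constructor
    · rintro ⟨h1, h2⟩
      rw [← Real.le_log_iff_exp_le h2]; linarith
    · intro h
      have h2 : 0 < t := (Real.exp_pos _).trans_le h
      rw [← Real.le_log_iff_exp_le h2] at h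
      exact ⟨by linarith, h2⟩
  rw [gumbel_Iic, Measure.map_apply hm measurableSet_Iic, withDensity_apply _ (hm measurableSet_Iic),
    Measure.restrict_restrict (hm measurableSet_Iic), hs,
    Measure.restrict_congr_set (Ioi_ae_eq_Ici (a := Real.exp (-x))).symm,
    ← ofReal_integral_eq_lintegral_ofReal (integrableOn_exp_neg_Ioi _)
      (ae_of_all _ fun t => (Real.exp_pos _).le), integral_exp_neg_Ioi]

lemma integrable_id_gumbel : Integrable (fun x : ℝ => x) gumbelCDF.measure := by
  have hm : Measurable (fun t : ℝ => -Real.log t) := Real.measurable_log.neg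
  rw [gumbel_eq_map_neg_log, integrable_map_measure (by fun_prop) hm.aemeasurable,
    integrable_withDensity_iff (by fun_prop) (ae_of_all _ fun _ => ENNReal.ofReal_lt_top)]
  refine integrableOn_log_mul_exp_neg.neg.congr (ae_of_all _ fun t => ?_)
  simp [ENNReal.toReal_ofReal (Real.exp_pos _).le]

lemma gumbelMean_eq : gumbelMean = Real.eulerMascheroniConstant := by
  have hm : Measurable (fun t : ℝ => -Real.log t) := Real.measurable_log.neg
  rw [gumbelMean, gumbel_eq_map_neg_log, integral_map hm.aemeasurable (by fun_prop),
    integral_withDensity_eq_integral_toReal_smul (by fun_prop)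
      (ae_of_all _ fun _ => ENNReal.ofReal_lt_top), ← neg_neg Real.eulerMascheroniConstant,
    ← integral_log_mul_exp_neg, ← integral_neg]
  refine integral_congr_ae (ae_of_all _ fun t => ?_)
  simp [ENNReal.toReal_ofReal (Real.exp_pos _).le, mul_comm]

/-- `u ↦ P(N ≥ k) - 1_{u < 0}` for a Poisson variable `N` with mean `e^{-u}`. -/
noncomputable def centredTail (k : ℕ) (u : ℝ) : ℝ :=
  poissonTail k (Real.exp (-u)) - (Set.Iio 0).indicator 1 u

lemma centredTail_one_of_nonneg {u : ℝ} (hu : 0 ≤ u) :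
    centredTail 1 u = 1 - Real.exp (-Real.exp (-u)) := by
  simp [centredTail, poissonTail, hu]

lemma centredTail_one_of_neg {u : ℝ} (hu : u < 0) :
    centredTail 1 u = -Real.exp (-Real.exp (-u)) := by
  simp [centredTail, poissonTail, hu]

lemma measurable_centredTail (k : ℕ) : Measurable (centredTail k) := by
  unfold centredTail poissonTail
  exact (by fun_prop : Measurable _).sub (measurable_one.indicator measurableSet_Iio)

lemma integrable_centredTail_one : Integrable (centredTail 1) := by
  have h : Integrable (fun u : ℝ => Real.exp (-|u|)) :=
    integrable_comp_abs (integrableOn_exp_neg_Ioi 0)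
  refine h.mono' (measurable_centredTail 1).aestronglyMeasurable (ae_of_all _ fun u => ?_)
  rcases lt_or_ge u 0 with hu | hu
  · rw [centredTail_one_of_neg hu, norm_neg, Real.norm_of_nonneg (Real.exp_pos _).le, abs_of_neg hu,
      Real.exp_le_exp]
    have := Real.add_one_le_exp (-u)
    linarith
  · have h1 := Real.add_one_le_exp (-Real.exp (-u))
    have h2 : Real.exp (-Real.exp (-u)) ≤ 1 := Real.exp_le_one_iff.2 (by linarith [Real.exp_pos (-u)])
    rw [centredTail_one_of_nonneg hu, Real.norm_of_nonneg (by linarith), abs_of_nonneg hu]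
    linarith

/-- The mean is the integral of `P(Y > t)` over `t > 0` minus that of `P(Y ≤ t)` over `t < 0`, by
the layer-cake formula for positive and negative parts. -/
lemma integral_centredTail_one : ∫ u, centredTail 1 u = gumbelMean := by
  have hi := integrable_id_gumbel
  have hp : ∫ x, max x 0 ∂gumbelCDF.measure = ∫ t in Set.Ioi (0 : ℝ), centredTail 1 t := by
    rw [hi.pos_part.integral_eq_integral_meas_lt (ae_of_all _ fun x => le_max_right _ _)]
    refine setIntegral_congr_fun measurableSet_Ioi fun t ht => ?_
    have ht0 : 0 < t := ht
    rw [centredTail_one_of_nonneg ht0.le, ← gumbel_real_Ioi]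
    congr 1
    ext x
    simp [ht0.not_gt]
  have hn : ∫ x, max (-x) 0 ∂gumbelCDF.measure = -∫ t in Set.Iic (0 : ℝ), centredTail 1 t := by
    rw [hi.neg_part.integral_eq_integral_meas_le (ae_of_all _ fun x => le_max_right _ _)]
    rw [← neg_zero, ← integral_comp_neg_Ioi, ← integral_neg, neg_zero]
    refine setIntegral_congr_fun measurableSet_Ioi fun t ht => ?_
    have ht0 : 0 < t := ht
    rw [centredTail_one_of_neg (neg_lt_zero.2 ht0), neg_neg, ← gumbel_real_Iic]
    congr 1
    ext x
    simp [ht0.not_ge, le_neg]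
  have hs : gumbelMean = (∫ x, max x 0 ∂gumbelCDF.measure) - ∫ x, max (-x) 0 ∂gumbelCDF.measure := by
    rw [gumbelMean, ← integral_sub hi.pos_part hi.neg_part]
    refine integral_congr_ae (ae_of_all _ fun x => ?_)
    rcases le_total x 0 with h | h <;> simp [h]
  rw [hs, hp, hn, sub_neg_eq_add, add_comm,
    ← setIntegral_union (Set.Iic_disjoint_Ioi le_rfl) measurableSet_Ioi
      integrable_centredTail_one.integrableOn integrable_centredTail_one.integrableOn,
    Set.Iic_union_Ioi, setIntegral_univ]

lemma image_exp_neg_univ : (fun u : ℝ => Real.exp (-u)) '' Set.univ = Set.Ioi 0 := by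
  ext t
  simp only [Set.image_univ, Set.mem_range, Set.mem_Ioi]
  exact ⟨fun ⟨u, hu⟩ => hu ▸ Real.exp_pos _, fun ht => ⟨-Real.log t, by simp [Real.exp_log ht]⟩⟩

/-- Puts the term in the form `|φ'| • f (φ u)` with `φ u = e^{-u}`, ready for the change of
variables to a Gamma integral. -/
lemma poisson_term_succ_exp_neg (m : ℕ) (u : ℝ) :
    Real.exp (-Real.exp (-u)) * Real.exp (-u) ^ (m + 1) / ((m + 1).factorial : ℝ) =
      (|-Real.exp (-u)| • (Real.exp (-Real.exp (-u)) * Real.exp (-u) ^ ((m + 1 : ℝ) - 1))) /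
        ((m + 1).factorial : ℝ) := by
  rw [add_sub_cancel_right, Real.rpow_natCast, abs_neg, abs_of_pos (Real.exp_pos _), smul_eq_mul]
  ring

lemma hasDerivWithinAt_exp_neg (u : ℝ) :
    HasDerivWithinAt (fun u : ℝ => Real.exp (-u)) (-Real.exp (-u)) Set.univ u := by
  have h : HasDerivAt (fun u : ℝ => Real.exp (-u)) (-Real.exp (-u)) u := by
    simpa using (hasDerivAt_neg u).exp
  exact h.hasDerivWithinAt

lemma injOn_exp_neg : Set.InjOn (fun u : ℝ => Real.exp (-u)) Set.univ := fun a _ b _ h => by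
  simpa using h

lemma integrable_poisson_term_succ (m : ℕ) : Integrable (fun u : ℝ =>
    Real.exp (-Real.exp (-u)) * Real.exp (-u) ^ (m + 1) / ((m + 1).factorial : ℝ)) := by
  simp_rw [poisson_term_succ_exp_neg]
  refine Integrable.div_const ?_ _
  rw [← integrableOn_univ]
  refine (integrableOn_image_iff_integrableOn_abs_deriv_smul MeasurableSet.univ
    (fun u _ => hasDerivWithinAt_exp_neg u) injOn_exp_neg
    (fun t : ℝ => Real.exp (-t) * t ^ ((m + 1 : ℝ) - 1))).1 ?_
  rw [image_exp_neg_univ]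
  exact Real.GammaIntegral_convergent (by positivity)

/-- Under `t = e^{-u}` the integral becomes `Γ(m + 1)/(m + 1)!`. -/
lemma integral_poisson_term_succ (m : ℕ) : ∫ u : ℝ,
    Real.exp (-Real.exp (-u)) * Real.exp (-u) ^ (m + 1) / ((m + 1).factorial : ℝ) =
      1 / ((m : ℝ) + 1) := by
  simp_rw [poisson_term_succ_exp_neg]
  have h := integral_image_eq_integral_abs_deriv_smul MeasurableSet.univ
    (fun u _ => hasDerivWithinAt_exp_neg u) injOn_exp_neg
    (fun t : ℝ => Real.exp (-t) * t ^ ((m + 1 : ℝ) - 1))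
  rw [image_exp_neg_univ, setIntegral_univ, ← Real.Gamma_eq_integral (by positivity),
    Real.Gamma_nat_eq_factorial] at h
  rw [integral_div, ← h, Nat.factorial_succ]
  have : (m.factorial : ℝ) ≠ 0 := by positivity
  push_cast
  field_simp

lemma centredTail_succ (k : ℕ) (u : ℝ) : centredTail (k + 1) u =
    centredTail k u - Real.exp (-Real.exp (-u)) * Real.exp (-u) ^ k / (k.factorial : ℝ) := by
  rw [centredTail, centredTail, poissonTail, poissonTail, Finset.sum_range_succ]
  ring

lemma integrable_centredTail_succ (m : ℕ) : Integrable (centredTail (m + 1)) := by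
  induction m with
  | zero => exact integrable_centredTail_one
  | succ m ih =>
    exact (ih.sub (integrable_poisson_term_succ m)).congr
      (ae_of_all _ fun u => (centredTail_succ (m + 1) u).symm)

lemma integral_centredTail_succ (m : ℕ) :
    ∫ u, centredTail (m + 1) u = gumbelMean - ∑ i ∈ Finset.range m, 1 / ((i : ℝ) + 1) := by
  induction m with
  | zero => simpa using integral_centredTail_one
  | succ m ih =>
    simp_rw [centredTail_succ (m + 1)]
    rw [integral_sub (integrable_centredTail_succ m) (integrable_poisson_term_succ m), ih,
      integral_poisson_term_succ, Finset.sum_range_succ]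
    ring

/-- This is the identity `H_0 + ... + H_{l-1} = l * H_l - l`. -/
lemma sum_sub_harmonic (c : ℝ) (l : ℕ) :
    ∑ m ∈ Finset.range l, (c - ∑ i ∈ Finset.range m, 1 / ((i : ℝ) + 1)) =
      l * (c + 1 - ∑ k ∈ Finset.Icc 1 l, 1 / (k : ℝ)) := by
  have h : ∀ l : ℕ, ∑ k ∈ Finset.Icc 1 l, 1 / (k : ℝ) =
      ∑ i ∈ Finset.range l, 1 / ((i : ℝ) + 1) := fun l => by
    induction l with
    | zero => simp
    | succ l ih => rw [Finset.sum_Icc_succ_top (by omega), ih, Finset.sum_range_succ]; push_cast; rfl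
  rw [h]
  induction l with
  | zero => simp
  | succ l ih =>
    rw [Finset.sum_range_succ, ih, Finset.sum_range_succ]
    push_cast
    field_simp
    ring

end Gumbel

/-! ### Dominated convergence for the centred order statistics -/

section limit

variable {L n k : ℕ}

lemma ae_gainLaw_nonneg (L : ℕ) : ∀ᵐ x ∂gainLaw L, 0 ≤ x := by
  rw [gainLaw, ae_map_iff measurable_gain.aemeasurable measurableSet_Ici]
  exact ae_of_all _ gain_nonneg

lemma integrable_id_gainLaw (hL : 1 ≤ L) : Integrable (fun x : ℝ => x) (gainLaw L) := by
  refine ⟨by fun_prop, ?_⟩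
  rw [hasFiniteIntegral_iff_ofReal (ae_gainLaw_nonneg L),
    lintegral_eq_lintegral_meas_lt _ (ae_gainLaw_nonneg L) (by fun_prop)]
  have : ∀ t ∈ Set.Ioi (0 : ℝ), gainLaw L {a | t < a} = ENNReal.ofReal (gammaTail L t) := by
    intro t ht
    rw [← gainLaw_real_Ioi hL (le_of_lt ht), ofReal_measureReal]
    rfl
  rw [setLIntegral_congr_fun measurableSet_Ioi this]
  exact (integrableOn_gammaTail L).lintegral_lt_top

/-- The integrand of `E[X_(n-k+1)] - a_n` as an integral over the line, centred at `a_n`. -/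
noncomputable def centredBinomTail (L k n : ℕ) (u : ℝ) : ℝ :=
  (Set.Ioi (-aSeq L n)).indicator
    (fun u => binomTail n k (gammaTail L (aSeq L n + u)) - (Set.Iio 0).indicator 1 u) u

lemma continuous_binomTail (n k : ℕ) : Continuous (binomTail n k) := by
  unfold binomTail
  fun_prop

lemma integral_orderStat_sub_aSeq (hL : 1 ≤ L) (hn : 2 ≤ n) (hk : 1 ≤ k) (hkn : k ≤ n) :
    (∫ x, orderStat x (n - k + 1) ∂(Measure.pi fun _ : Fin n => gainLaw L)) - aSeq L n =
      ∫ u, centredBinomTail L k n u := by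
  obtain ⟨ha0, -⟩ := aSeq_spec hL hn
  have hint : IntegrableOn (fun t => binomTail n k (gammaTail L t)) (Set.Ioi 0) := by
    refine ((integrableOn_gammaTail L).const_mul (n : ℝ)).mono'
      ((continuous_binomTail n k).comp (continuous_gammaTail L)).aestronglyMeasurable ?_
    refine (ae_restrict_iff' measurableSet_Ioi).2 (ae_of_all _ fun t ht => ?_)
    have ht0 : 0 ≤ t := le_of_lt ht
    rw [Real.norm_of_nonneg (binomTail_nonneg (gammaTail_nonneg L ht0) (gammaTail_le_one hL ht0) hkn)]
    exact binomTail_le_mul (gammaTail_nonneg L ht0) (gammaTail_le_one hL ht0) hk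
  have hind : IntegrableOn ((Set.Iio (aSeq L n)).indicator (1 : ℝ → ℝ)) (Set.Ioi 0) := by
    rw [IntegrableOn, integrable_indicator_iff measurableSet_Iio, IntegrableOn,
      Measure.restrict_restrict measurableSet_Iio]
    refine integrableOn_const (hs := ?_)
    rw [Set.inter_comm, Set.Ioi_inter_Iio]
    simp
  -- Writing `a_n ≥ 0` as an integral over the same half-line puts the centring under the integral
  -- sign; the translation by `a_n` then moves the jump to `0`.
  have ha : aSeq L n = ∫ t in Set.Ioi (0 : ℝ), (Set.Iio (aSeq L n)).indicator (1 : ℝ → ℝ) t := by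
    rw [setIntegral_indicator measurableSet_Iio, Set.Ioi_inter_Iio]
    simp [ha0]
  rw [integral_orderStat (ae_gainLaw_nonneg L) (integrable_id_gainLaw hL) hk hkn,
    setIntegral_congr_fun measurableSet_Ioi (g := fun t => binomTail n k (gammaTail L t))
      fun t ht => by simp only [gainLaw_real_Ioi hL (le_of_lt ht)]]
  nth_rewrite 1 [ha]
  rw [← integral_sub hint hind, ← integral_indicator measurableSet_Ioi,
    ← integral_add_left_eq_self _ (aSeq L n)]
  refine integral_congr_ae (ae_of_all _ fun u => ?_)
  have h1 : aSeq L n + u ∈ Set.Ioi 0 ↔ u ∈ Set.Ioi (-aSeq L n) := by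
    simp only [Set.mem_Ioi]
    constructor <;> intro h <;> linarith
  have h2 : aSeq L n + u ∈ Set.Iio (aSeq L n) ↔ u ∈ Set.Iio 0 := by
    simp only [Set.mem_Iio]
    constructor <;> intro h <;> linarith
  simp only [centredBinomTail, Set.indicator_apply, h1, h2]
  rfl

/-- The bound is independent of `n` because `n * G a_n = 1`. For `u ≥ 0`, `n * G (a_n + u) ≤ G u`;
for `u < 0`, `a_n = (a_n + u) + (-u)` bounds `1/(n * G (a_n + u))` by `G (-u)`. -/
lemma norm_centredBinomTail_le (hL : 1 ≤ L) (hn : 2 ≤ n) (hk : 1 ≤ k) (hkn : k ≤ n) (u : ℝ) :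
    ‖centredBinomTail L k n u‖ ≤ (k : ℝ) ^ 2 * gammaTail L |u| := by
  obtain ⟨ha0, ha⟩ := aSeq_spec hL hn
  have hn0 : (0 : ℝ) < n := by positivity
  have hG := gammaTail_nonneg L (abs_nonneg u)
  by_cases hu : u ∈ Set.Ioi (-aSeq L n)
  swap
  · rw [centredBinomTail, Set.indicator_of_notMem hu, norm_zero]
    positivity
  have hu0 : 0 ≤ aSeq L n + u := by
    have : -aSeq L n < u := hu
    linarith
  have hp0 := gammaTail_nonneg L hu0
  have hp1 := gammaTail_le_one hL hu0
  rw [centredBinomTail, Set.indicator_of_mem hu]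
  rcases lt_or_ge u 0 with hneg | hpos
  · rw [Set.indicator_of_mem (show u ∈ Set.Iio 0 from hneg), Pi.one_apply, norm_sub_rev,
      Real.norm_of_nonneg (sub_nonneg.2 (binomTail_le_one hp0 hp1 k)), abs_of_neg hneg]
    rw [abs_of_neg hneg] at hG
    have h1 := gammaTail_add_le L hu0 (neg_nonneg.2 hneg.le)
    -- Now `h1` reads `1 ≤ G (a_n + u) * G (-u) * n`, the factor inserted below.
    rw [add_neg_cancel_right, ha, div_le_iff₀ hn0] at h1
    calc 1 - binomTail n k (gammaTail L (aSeq L n + u))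
        = (1 - binomTail n k (gammaTail L (aSeq L n + u))) * 1 := (mul_one _).symm
      _ ≤ (1 - binomTail n k (gammaTail L (aSeq L n + u))) *
          (gammaTail L (aSeq L n + u) * gammaTail L (-u) * n) :=
          mul_le_mul_of_nonneg_left h1 (sub_nonneg.2 (binomTail_le_one hp0 hp1 k))
      _ = (1 - binomTail n k (gammaTail L (aSeq L n + u))) * (n * gammaTail L (aSeq L n + u)) *
          gammaTail L (-u) := by ring
      _ ≤ _ := mul_le_mul_of_nonneg_right (one_sub_binomTail_mul_le hp0 hp1 hkn) hG
  · rw [Set.indicator_of_notMem (show u ∉ Set.Iio 0 from not_lt.2 hpos), sub_zero,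
      Real.norm_of_nonneg (binomTail_nonneg hp0 hp1 hkn), abs_of_nonneg hpos]
    rw [abs_of_nonneg hpos] at hG
    have h1 := gammaTail_add_le L ha0 hpos
    rw [ha] at h1
    have hk1 : (1 : ℝ) ≤ (k : ℝ) ^ 2 := one_le_pow₀ (by exact_mod_cast hk)
    calc _ ≤ n * gammaTail L (aSeq L n + u) := binomTail_le_mul hp0 hp1 hk
      _ ≤ n * (1 / n * gammaTail L u) := mul_le_mul_of_nonneg_left h1 hn0.le
      _ = 1 * gammaTail L u := by field_simp
      _ ≤ _ := mul_le_mul_of_nonneg_right hk1 hG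

lemma tendsto_centredBinomTail (hL : 1 ≤ L) (k : ℕ) (u : ℝ) :
    Tendsto (fun n => centredBinomTail L k n u) atTop (𝓝 (centredTail k u)) := by
  have h1 := (tendsto_gammaTail_add_div hL u).comp (tendsto_aSeq hL)
  have h2 : Tendsto (fun n : ℕ => n * gammaTail L (aSeq L n + u)) atTop (𝓝 (Real.exp (-u))) := by
    refine h1.congr' ?_
    filter_upwards [eventually_ge_atTop 2] with n hn
    rw [Function.comp_apply, (aSeq_spec hL hn).2, div_div_eq_mul_div, div_one, mul_comm]
  refine ((tendsto_binomTail k h2).sub_const ((Set.Iio 0).indicator 1 u)).congr' ?_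
  filter_upwards [(tendsto_aSeq hL).eventually_gt_atTop (-u)] with n hn
  rw [centredBinomTail, Set.indicator_of_mem (s := Set.Ioi (-aSeq L n)) (neg_lt.1 hn)]

lemma tendsto_integral_orderStat_sub_aSeq (hL : 1 ≤ L) (hk : 1 ≤ k) :
    Tendsto (fun n => (∫ x, orderStat x (n - k + 1) ∂(Measure.pi fun _ : Fin n => gainLaw L)) -
      aSeq L n) atTop (𝓝 (∫ u, centredTail k u)) := by
  have h : Tendsto (fun n => ∫ u, centredBinomTail L k n u) atTop (𝓝 (∫ u, centredTail k u)) := by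
    refine tendsto_integral_filter_of_dominated_convergence
      (fun u => (k : ℝ) ^ 2 * gammaTail L |u|) ?_ ?_
      ((integrable_comp_abs (integrableOn_gammaTail L)).const_mul _)
      (ae_of_all _ fun u => tendsto_centredBinomTail hL k u)
    · refine Eventually.of_forall fun n => ?_
      refine Measurable.aestronglyMeasurable (Measurable.indicator ?_ measurableSet_Ioi)
      refine Measurable.sub ?_ (measurable_one.indicator measurableSet_Iio)
      exact ((continuous_binomTail n k).comp
        ((continuous_gammaTail L).comp (by fun_prop))).measurable
    · filter_upwards [eventually_ge_atTop 2, eventually_ge_atTop k] with n hn hkn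
      exact ae_of_all _ (norm_centredBinomTail_le hL hn hk hkn)
  refine h.congr' ?_
  filter_upwards [eventually_ge_atTop 2, eventually_ge_atTop k] with n hn hkn
  exact (integral_orderStat_sub_aSeq hL hn hk hkn).symm

lemma integrable_topSum (hL : 1 ≤ L) {l : ℕ} (hln : l ≤ n) :
    Integrable (fun x => topSum l x) (Measure.pi fun _ : Fin n => gainLaw L) := by
  refine integrable_finsetSum _ fun k hk => ?_
  rw [Finset.mem_Icc] at hk
  exact integrable_orderStat (ae_gainLaw_nonneg L) (integrable_id_gainLaw hL) hk.1 (by omega)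

lemma tendsto_integral_topSum (hL : 1 ≤ L) (l : ℕ) :
    Tendsto (fun n => (∫ x, topSum l x ∂(Measure.pi fun _ : Fin n => gainLaw L)) - l * aSeq L n)
      atTop (𝓝 (l * (gumbelMean + 1 - ∑ k ∈ Finset.Icc 1 l, 1 / (k : ℝ)))) := by
  rw [← sum_sub_harmonic]
  simp_rw [← integral_centredTail_succ]
  refine (tendsto_finsetSum (Finset.range l) fun m _ =>
    tendsto_integral_orderStat_sub_aSeq (k := m + 1) hL (by omega)).congr' ?_
  filter_upwards [eventually_ge_atTop l] with n hn
  have h1 : ∫ x, topSum l x ∂(Measure.pi fun _ : Fin n => gainLaw L) =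
      ∑ m ∈ Finset.range l,
        ∫ x, orderStat x (n - (m + 1) + 1) ∂(Measure.pi fun _ : Fin n => gainLaw L) := by
    have : ∀ x : Fin n → ℝ, topSum l x =
        ∑ m ∈ Finset.range l, orderStat x (n - (m + 1) + 1) := fun x => by
      rw [topSum, ← Finset.Ico_add_one_right_eq_Icc, Finset.sum_Ico_eq_sum_range]
      refine Finset.sum_congr (by simp) fun m _ => by rw [add_comm 1 m]
    simp_rw [this]
    refine integral_finsetSum _ fun m hm => ?_
    rw [Finset.mem_range] at hm
    exact integrable_orderStat (ae_gainLaw_nonneg L) (integrable_id_gainLaw hL) (by omega) (by omega)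
  rw [h1, Finset.sum_sub_distrib, Finset.sum_const, Finset.card_range, nsmul_eq_mul]

end limit

/-! ### Transfer to the given random variables -/

lemma hasLaw_gain_pi {Ω : Type*} [MeasurableSpace Ω] {P : Measure Ω} [IsProbabilityMeasure P]
    {L : ℕ} {h : ℕ → Fin L → Ω → ℂ} (h_law : ∀ i j, HasLaw (h i j) stdComplexGaussian P)
    (h_indep : iIndepFun (fun p : ℕ × Fin L => h p.1 p.2) P) (n : ℕ) :
    HasLaw (fun ω (i : Fin n) => gain (fun j => h i j ω)) (Measure.pi fun _ => gainLaw L) P := by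
  have hinj : Function.Injective (fun p : Fin n × Fin L => ((p.1 : ℕ), p.2)) := fun p q hpq => by
    simp only [Prod.mk.injEq] at hpq
    exact Prod.ext (Fin.ext hpq.1) hpq.2
  have h1 : iIndepFun (fun p : Fin n × Fin L => h p.1 p.2) P := h_indep.precomp hinj
  have h2 : HasLaw (fun ω (p : Fin n × Fin L) => h p.1 p.2 ω)
      (Measure.infinitePi fun _ => stdComplexGaussian) P :=
    h1.hasLaw_infinitePi (fun p => h_law p.1 p.2)
      (aemeasurable_pi_lambda _ fun p => (h_law p.1 p.2).aemeasurable)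
  -- Currying groups the independent entries into independent rows, one for each gain.
  have h3 : HasLaw (MeasurableEquiv.curry (Fin n) (Fin L) ℂ)
      (Measure.pi fun _ : Fin n => Measure.pi fun _ : Fin L => stdComplexGaussian)
      (Measure.infinitePi fun _ : Fin n × Fin L => stdComplexGaussian) := by
    refine ⟨(MeasurableEquiv.measurable _).aemeasurable, ?_⟩
    rw [Measure.infinitePi_map_curry (fun _ _ => stdComplexGaussian)]
    simp_rw [Measure.infinitePi_eq_pi]
  have h4 : HasLaw (fun (z : Fin n → Fin L → ℂ) i => gain (z i)) (Measure.pi fun _ => gainLaw L)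
      (Measure.pi fun _ : Fin n => Measure.pi fun _ : Fin L => stdComplexGaussian) := by
    refine ⟨(measurable_pi_lambda _ fun i =>
      measurable_gain.comp (measurable_pi_apply i)).aemeasurable, ?_⟩
    exact Measure.pi_map_pi (fun _ => measurable_gain.aemeasurable)
  exact (h4.comp h3).comp h2

theorem theorem1 {Ω : Type*} [MeasurableSpace Ω] (P : Measure Ω) [IsProbabilityMeasure P]
    (L : ℕ) (hL : 1 ≤ L) (h : ℕ → Fin L → Ω → ℂ)
    (h_law : ∀ i j, HasLaw (h i j) stdComplexGaussian P)
    (h_indep : iIndepFun (fun p : ℕ × Fin L => h p.1 p.2) P)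
    (l : ℕ) (hl : 1 ≤ l) :
    (∀ n : ℕ, l ≤ n → Integrable (fun ω =>
      (topSum l (fun i : Fin n => gain (fun j => h i j ω)) - (l : ℝ) * aSeq L n) / bSeq L n) P) ∧
    Tendsto (fun n : ℕ => ∫ ω,
      (topSum l (fun i : Fin n => gain (fun j => h i j ω)) - (l : ℝ) * aSeq L n) / bSeq L n ∂P)
      atTop (𝓝 ((l : ℝ) * (gumbelMean + 1 - ∑ k ∈ Finset.Icc 1 l, 1 / (k : ℝ)))) ∧
    Integrable (fun x : ℝ => x) gumbelCDF.measure ∧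
    gumbelMean = Real.eulerMascheroniConstant := by
  have hlaw := hasLaw_gain_pi h_law h_indep
  have hint : ∀ n, l ≤ n →
      Integrable (fun ω => topSum l (fun i : Fin n => gain (fun j => h i j ω))) P := by
    intro n hn
    have h1 := integrable_topSum (L := L) hL hn
    rw [← (hlaw n).map_eq] at h1
    exact h1.comp_aemeasurable (hlaw n).aemeasurable
  refine ⟨fun n hn => ((hint n hn).sub (integrable_const _)).div_const _, ?_,
    integrable_id_gumbel, gumbelMean_eq⟩
  have hlim := (tendsto_integral_topSum hL l).div (tendsto_bSeq hL) one_ne_zero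
  rw [div_one] at hlim
  refine hlim.congr' ?_
  filter_upwards [eventually_ge_atTop l] with n hn
  rw [Pi.div_apply, integral_div, integral_sub (hint n hn) (integrable_const _), integral_const,
    ← (hlaw n).integral_comp (integrable_topSum hL hn).aestronglyMeasurable]
  simp
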